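/- Let $p$ be a natural number and fix constants $0<b_{min}<1$ and $0<\rho_{min}<\rho_{max}<1$. Let $\tilde\Theta$ be the set of all $\tilde\theta=(\mathbf A,\tilde{\mathbf A},\mathbf b,\rho_w)$, $\mathbf A,\tilde{\mathbf A}\in\mathbb R^{p\times p}$, $\mathbf b,\rho_w\in\mathbb R^p$, with $\sum_{j}(a_{ij}+\tilde a_{ij})+b_i=1$, $b_i\ge b_{min}$, $\rho_{w_i}\in[\rho_{min},\rho_{max}]$, $a_{ij},\tilde a_{ij}\ge 0$ and $a_{ij}\tilde a_{ij}=0$ for all $i,j$. A generic BAR process with parameters $\tilde\theta\in\tilde\Theta$ is a process $\mathbf X(k)\in\{0,1\}^p$, $k\ge 0$, with arbitrary initial distribution, such that, given the past, $\mathbf W(k+1)$ has independent entries $W_i(k+1)\sim\mathrm{Ber}(\rho_{w_i})$, independent of the past, and, given the past and $\mathbf W(k+1)$, the entries of $\mathbf X(k+1)$ are independent with $$X_i(k+1)\sim \mathrm{Ber}\big(\mathbf a_i^\top\mathbf X(k)+\tilde{\mathbf a}_i^\top(\mathbf 1-\mathbf X(k))+b_iW_i(k+1)\big),$$ where $\mathbf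 a_i^\top,\tilde{\mathbf a}_i^\top$ are the $i$-th rows of $\mathbf A,\tilde{\mathbf A}$. Put $\bar{\mathbf A}=\mathbf A-\tilde{\mathbf A}$ (with rows $\bar{\mathbf a}_i^\top$) and $\bar{\mathbf c}=\tilde{\mathbf A}\mathbf 1+\mathbf c$, where $c_i=b_i\rho_{w_i}$. For a sequence $\mathbf x(0),\dots,\mathbf x(T)$ in $\{0,1\}^p$ let $N_{\mathbf u}$ be the number of $k<T$ with $\mathbf x(k)=\mathbf u$ and $N_{\mathbf u,r,1}$ the number of $k<T$ with $\mathbf x(k)=\mathbf u$ and $x_r(k+1)=1$. Let $\mathbf u_1,\dots,\mathbf u_m$ be the distinct states among $\mathbf x(0),\dots,\mathbf x(T-1)$, let $\mathbf U_m\in\mathbb R^{m\times p}$ have rows $\mathbf u_k^\top$, and let $\mathbf y_{m,r}=(N_{\mathbf u_k,r,1}/N_{\mathbf u_k})_{k\le m}$. Call the data good if $\mathbf 0_p$ is among $\mathbf u_1,\dots,\mathbf u_m$ and $\mathbf U_m$ has full column rank $p$ (so $p\le m\le 2^p$). Define $$\hat{\bar c}_i=\frac{N_{\mathbf 0,i,1}}{N_{\mathbf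 0}},\qquad \hat{\bar{\mathbf a}}_r=(\mathbf U_m^\top\mathbf U_m)^{-1}\mathbf U_m^\top(\mathbf y_{m,r}-\hat{\bar c}_r\mathbf 1_m),$$ let $\hat{\bar{\mathbf A}}$ be the matrix with rows $\hat{\bar{\mathbf a}}_r^\top$, let $\hat{\mathbf A}$ and $\hat{\tilde{\mathbf A}}$ be the entrywise positive and negative parts of $\hat{\bar{\mathbf A}}$, and let $\hat{\mathbf b}=\mathbf 1-(\hat{\mathbf A}+\hat{\tilde{\mathbf A}})\mathbf 1$, $\hat{\mathbf c}=\hat{\bar{\mathbf c}}-\hat{\tilde{\mathbf A}}\mathbf 1$, $\hat\rho_w=\mathrm{diag}(\hat{\mathbf b})^{-1}\hat{\mathbf c}$. (Conventions where these formulas are undefined: $x/0=0$, and the inverse of a singular matrix is $0$.) The closed-form estimator $\hat{\bar\theta}_T$ is the support-preserving projection of $(\hat{\mathbf A},\hat{\tilde{\mathbf A}},\hat{\mathbf b},\hat\rho_w)$ onto $\tilde\Theta$, i.e. the Euclidean-nearest point among the elements of $\tilde\Theta$ whose first two components vanish wherever $\hat{\mathbf A}$, respectively $\hat{\tilde{\mathbf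 A}}$, vanishes; its values for data that are not good or for which some $\hat b_i=0$ may be arbitrary. Then: 1. For every $\tilde\theta\in\tilde\Theta$, $\tilde\theta$ is recovered from $(\bar{\mathbf A},\bar{\mathbf c})$ by the same formulas: $\mathbf A$ and $\tilde{\mathbf A}$ are the positive and negative parts of $\bar{\mathbf A}$, $\mathbf b=\mathbf 1-(\mathbf A+\tilde{\mathbf A})\mathbf 1$, and $\rho_w=\mathrm{diag}(\mathbf b)^{-1}(\bar{\mathbf c}-\tilde{\mathbf A}\mathbf 1)$. 2. For good data, $\mathbf U_m^\top\mathbf U_m$ is invertible and, for every $r$, $\hat{\bar{\mathbf a}}_r$ is the unique minimizer over $\mathbf a\in\mathbb R^p$ of $\|\mathbf y_{m,r}-\hat{\bar c}_r\mathbf 1_m-\mathbf U_m\mathbf a\|^2$. 3. For all data, the support-preserving projection exists and is unique (and lies in $\tilde\Theta$). 4. For every generic BAR process with parameters $\tilde\theta\in\tilde\Theta$: $P(X_i(k+1)=1,\mathbf X(k)=\mathbf u)=P(\mathbf X(k)=\mathbf u)\,(\bar{\mathbf a}_i^\top\mathbf u+\bar c_i)$ for all $k,\mathbf u,i$; almost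 surely, for all sufficiently large $T$ the data are good and all $\hat b_i\neq 0$; and, almost surely as $T\to\infty$, $(\hat{\bar{\mathbf A}},\hat{\bar{\mathbf c}})\to(\bar{\mathbf A},\bar{\mathbf c})$, $(\hat{\mathbf A},\hat{\tilde{\mathbf A}},\hat{\mathbf b},\hat\rho_w)\to\tilde\theta$ and $\hat{\bar\theta}_T\to\tilde\theta$. That is, the closed-form estimator is strongly consistent. -/

import Mathlib

open MeasureTheory Filter Topology

noncomputable section

namespace BAR

/-- The state space `{0,1}^p`. -/
abbrev State (p : ℕ) : Type := Fin p → Bool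

/-- The numerical value `0` or `1` of a bit. -/
def val (s : Bool) : ℝ := if s then 1 else 0

/-- The all-zeros state. -/
def zeroState (p : ℕ) : State p := fun _ => false

/-- A parameter tuple `(A, Ã, b, ρ_w)`, without constraints. -/
structure Params (p : ℕ) where
  /-- the weights `A` of the positive influences -/
  A : Matrix (Fin p) (Fin p) ℝ
  /-- the weights `Ã` of the negative influences -/
  Aneg : Matrix (Fin p) (Fin p) ℝ
  /-- the noise weights `b` -/
  b : Fin p → ℝ
  /-- the noise parameters `ρ_w` -/
  rho : Fin p → ℝ

/-- The parameter space `Θ̃` of the generic BAR model. -/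
def paramSpace (p : ℕ) (bmin rhomin rhomax : ℝ) : Set (Params p) :=
  {θ | ∀ i, (∑ j, (θ.A i j + θ.Aneg i j) + θ.b i = 1) ∧ bmin ≤ θ.b i ∧
      rhomin ≤ θ.rho i ∧ θ.rho i ≤ rhomax ∧
      ∀ j, 0 ≤ θ.A i j ∧ 0 ≤ θ.Aneg i j ∧ θ.A i j * θ.Aneg i j = 0}

/-- The squared Euclidean distance between two parameter tuples. -/
def distSq {p : ℕ} (θ θ' : Params p) : ℝ :=
  ∑ i, ∑ j, (θ.A i j - θ'.A i j) ^ 2 + ∑ i, ∑ j, (θ.Aneg i j - θ'.Aneg i j) ^ 2 +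
    ∑ i, (θ.b i - θ'.b i) ^ 2 + ∑ i, (θ.rho i - θ'.rho i) ^ 2

/-- Convergence of a sequence of parameter tuples, in all components. -/
def ConvergesTo {p : ℕ} (θ : ℕ → Params p) (θ₀ : Params p) : Prop :=
  Tendsto (fun T => (θ T).A) atTop (𝓝 θ₀.A) ∧
  Tendsto (fun T => (θ T).Aneg) atTop (𝓝 θ₀.Aneg) ∧
  Tendsto (fun T => (θ T).b) atTop (𝓝 θ₀.b) ∧
  Tendsto (fun T => (θ T).rho) atTop (𝓝 θ₀.rho)

/-! ### The generic BAR process -/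

/-- The mass that the Bernoulli distribution with parameter `q` gives to `s`. -/
def bern (q : ℝ) (s : Bool) : ℝ := if s then q else 1 - q

/-- The Bernoulli argument `a_iᵀ u + ã_iᵀ (1 - u) + b_i w_i` of node `i`, when the current state is
`u` and the value of the noise is `w`. -/
def bernArg {p : ℕ} (θ : Params p) (u w : State p) (i : Fin p) : ℝ :=
  ∑ j, θ.A i j * val (u j) + ∑ j, θ.Aneg i j * (1 - val (u j)) + θ.b i * val (w i)

/-- The event that `X` follows `x` up to time `n` and `W` follows `w` at times `1, …, n`. -/
def cylinder {p : ℕ} {Ω : Type*} (X W : ℕ → Ω → State p) (x w : ℕ → State p) (n : ℕ) : Set Ω :=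
  {ω | (∀ k ≤ n, X k ω = x k) ∧ ∀ k < n, W (k + 1) ω = w (k + 1)}

/-- `X` is a generic BAR process with parameters `θ` and noise `W`, with an arbitrary initial
distribution: given the past `X 0, W 1, X 1, …, W n, X n`, the noise variables `W (n+1) i` are
independent with distributions `Ber (ρ_{w_i})`, whatever the past is, and given the past and
`W (n+1)`, the variables `X (n+1) i` are independent with distributions
`Ber (a_iᵀ X n + ã_iᵀ (1 - X n) + b_i W (n+1) i)`. -/
structure IsGenericBAR {p : ℕ} {Ω : Type*} [MeasurableSpace Ω] (θ : Params p) (μ : Measure Ω)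
    (X W : ℕ → Ω → State p) : Prop where
  measurable_X : ∀ k, Measurable (X k)
  measurable_W : ∀ k, Measurable (W k)
  law_step : ∀ (n : ℕ) (x w : ℕ → State p),
    μ.real (cylinder X W x w (n + 1)) =
      μ.real (cylinder X W x w n) * (∏ i, bern (θ.rho i) (w (n + 1) i)) *
        ∏ i, bern (bernArg θ (x n) (w (n + 1)) i) (x (n + 1) i)

/-! ### The reparametrization -/

/-- `Ā = A - Ã`. -/
def Params.Abar {p : ℕ} (θ : Params p) : Matrix (Fin p) (Fin p) ℝ := θ.A - θ.Aneg

/-- `c̄ = Ã 1 + c`, where `c_i = b_i ρ_{w_i}`. -/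
def Params.cbar {p : ℕ} (θ : Params p) : Fin p → ℝ :=
  fun i => ∑ j, θ.Aneg i j + θ.b i * θ.rho i

/-- The tuple `(A, Ã, b, ρ_w)` computed from `(Ā, c̄)`: `A` and `Ã` are separated by the signs of
the entries of `Ā`, `b = 1 - (A + Ã) 1`, `c = c̄ - Ã 1` and `ρ_w = diag(b)⁻¹ c`. -/
def recover {p : ℕ} (Abar : Matrix (Fin p) (Fin p) ℝ) (cbar : Fin p → ℝ) : Params p where
  A := fun i j => max (Abar i j) 0
  Aneg := fun i j => max (-Abar i j) 0
  b := fun i => 1 - ∑ j, (max (Abar i j) 0 + max (-Abar i j) 0)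
  rho := fun i => (cbar i - ∑ j, max (-Abar i j) 0) /
    (1 - ∑ j, (max (Abar i j) 0 + max (-Abar i j) 0))

/-! ### The closed-form estimator, from observations `x 0, …, x T` -/

/-- `N_u`: the number of `k < T` with `x k = u`. -/
def count {p : ℕ} (x : ℕ → State p) (T : ℕ) (u : State p) : ℕ :=
  ((Finset.range T).filter (fun k => x k = u)).card

/-- `N_{u,r,1}`: the number of `k < T` with `x k = u` and `x_r (k+1) = 1`. -/
def countOne {p : ℕ} (x : ℕ → State p) (T : ℕ) (u : State p) (r : Fin p) : ℕ :=
  ((Finset.range T).filter (fun k => x k = u ∧ x (k + 1) r = true)).card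

/-- The distinct states among `x 0, …, x (T-1)`. -/
def visited {p : ℕ} (x : ℕ → State p) (T : ℕ) : Finset (State p) :=
  (Finset.range T).image x

/-- The matrix `U_m`, whose rows are the distinct visited states. -/
def Umat {p : ℕ} (x : ℕ → State p) (T : ℕ) : Matrix {u // u ∈ visited x T} (Fin p) ℝ :=
  Matrix.of fun u j => val (u.1 j)

/-- The vector `y_{m,r}` of the ratios `N_{u,r,1} / N_u` over the visited states `u`. -/
def yvec {p : ℕ} (x : ℕ → State p) (T : ℕ) (r : Fin p) : {u // u ∈ visited x T} → ℝ :=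
  fun u => (countOne x T u.1 r : ℝ) / (count x T u.1 : ℝ)

/-- The estimator of `c̄`: the frequencies of ones after the zero state. -/
def cbarHat {p : ℕ} (x : ℕ → State p) (T : ℕ) : Fin p → ℝ :=
  fun i => (countOne x T (zeroState p) i : ℝ) / (count x T (zeroState p) : ℝ)

/-- The estimator of `Ā`: row `r` is `(Uᵀ U)⁻¹ Uᵀ (y_r - ĉ_r 1)`. -/
def AbarHat {p : ℕ} (x : ℕ → State p) (T : ℕ) : Matrix (Fin p) (Fin p) ℝ :=
  Matrix.of fun r => Matrix.mulVec (((Umat x T).transpose * Umat x T)⁻¹)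
    (Matrix.mulVec (Umat x T).transpose (fun u => yvec x T r u - cbarHat x T r))

/-- The unprojected estimator `(Â, Ã̂, b̂, ρ̂_w)`. -/
def rawEstimate {p : ℕ} (x : ℕ → State p) (T : ℕ) : Params p :=
  recover (AbarHat x T) (cbarHat x T)

/-- The standing assumptions on the data: the zero state is visited before time `T`, and `U_m` has
full column rank (so that at least `p` distinct states are visited). -/
def GoodData {p : ℕ} (x : ℕ → State p) (T : ℕ) : Prop :=
  zeroState p ∈ visited x T ∧ (Umat x T).rank = p

/-- The sum of squares `‖y_r - ĉ_r 1 - U a‖²`. -/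
def residual {p : ℕ} (x : ℕ → State p) (T : ℕ) (r : Fin p) (a : Fin p → ℝ) : ℝ :=
  ∑ u, (yvec x T r u - cbarHat x T r - Matrix.mulVec (Umat x T) a u) ^ 2

/-- The tuples of the parameter space whose `A` and `Ã` vanish wherever those of `θ` do. -/
def supportSpace {p : ℕ} (bmin rhomin rhomax : ℝ) (θ : Params p) : Set (Params p) :=
  {θ' | θ' ∈ paramSpace p bmin rhomin rhomax ∧
    (∀ i j, θ.A i j = 0 → θ'.A i j = 0) ∧ (∀ i j, θ.Aneg i j = 0 → θ'.Aneg i j = 0)}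

/-- `θ'` is a support-preserving projection of `θ` onto the parameter space: a nearest point of
the part of the parameter space that is carried by the supports of `θ.A` and `θ.Aneg`. -/
def IsSupportProjection {p : ℕ} (bmin rhomin rhomax : ℝ) (θ θ' : Params p) : Prop :=
  θ' ∈ supportSpace bmin rhomin rhomax θ ∧
    ∀ θ'' ∈ supportSpace bmin rhomin rhomax θ, distSq θ θ' ≤ distSq θ θ''

/-- `est` is the closed-form estimator: whenever all the formulas are meaningful, it is the
support-preserving projection of the unprojected estimate. For other data its value is
arbitrary. -/
def IsClosedFormEstimator {p : ℕ} (bmin rhomin rhomax : ℝ)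
    (est : (ℕ → State p) → ℕ → Params p) : Prop :=
  ∀ (x : ℕ → State p) (T : ℕ), GoodData x T → (∀ i, (rawEstimate x T).b i ≠ 0) →
    IsSupportProjection bmin rhomin rhomax (rawEstimate x T) (est x T)

end BAR

end

/-! Summing out the noise turns `X` into a Markov chain on a finite state space. Given `X k = u`,
the coordinates of `X (k+1)` are independent, and node `i` takes the value `1` with probability
`oneProb θ u i = ā_iᵀ u + c̄_i`, which is affine in `u`. The noise keeps these probabilities
strictly inside `(0,1)`, so all transition probabilities exceed some `δ > 0`.

No ergodic theorem is needed. If `f (X k) (X (k+1))` has conditional mean zero, its partial sums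
have orthogonal bounded increments, hence second moments of order `n`. The averages then tend to
zero almost surely along the squares, and by boundedness along all times (`ae_tendsto_average`). One
choice of `f` shows that each state is visited with frequency eventually at least `δ / 2`; another
shows that the ratios `N_{u,r,1} / N_u` converge to `oneProb θ u r` (`ae_counts`).

Once every state has been visited, the Gram matrix is a fixed invertible matrix, and least squares
is a fixed linear map of the ratios. The limiting ratios minus `c̄_r` are exactly `ā_rᵀ u`, so the
limit of the estimator is `Ā`. The map `recover` is continuous at `(Ā, c̄)` because `b_i > 0`, and
it returns `θ` there.

For the projection, fixing the supports removes the nonconvexity caused by `a ã = 0` and leaves a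
compact set closed under midpoints, so the nearest point exists and is unique. The true `θ`
eventually satisfies the support constraints, so the projection is no farther from the raw estimate
than `θ` is, and that distance tends to zero. -/

namespace BAR

/-! ### The transition probabilities -/

/-- The probability that node `i` takes the value `1` after the state `u`. -/
noncomputable def oneProb {p : ℕ} (θ : Params p) (u : State p) (i : Fin p) : ℝ :=
  ∑ j, θ.Abar i j * val (u j) + θ.cbar i

/-- The transition probability from `u` to `v`. -/
noncomputable def trans {p : ℕ} (θ : Params p) (u v : State p) : ℝ :=
  ∏ i, bern (oneProb θ u i) (v i)

lemma sum_bern (q : ℝ) : ∑ s, bern q s = 1 := by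
  simp [bern]

lemma val_nonneg (s : Bool) : 0 ≤ val s := by
  unfold val; split_ifs <;> norm_num

lemma val_le_one (s : Bool) : val s ≤ 1 := by
  unfold val; split_ifs <;> norm_num

/-- The sum factorises over the nodes, and a Bernoulli mass is affine in its parameter: averaging
over `w i` replaces `w i` by its mean `ρ_i`. -/
lemma sum_noise_eq_trans {p : ℕ} (θ : Params p) (u v : State p) :
    ∑ w : State p, (∏ i, bern (θ.rho i) (w i)) * ∏ i, bern (bernArg θ u w i) (v i) =
      trans θ u v := by
  let g : Fin p → Bool → ℝ := fun i s => bern (θ.rho i) s *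
    bern (∑ j, θ.A i j * val (u j) + ∑ j, θ.Aneg i j * (1 - val (u j)) + θ.b i * val s) (v i)
  have h1 : ∀ w : State p, (∏ i, bern (θ.rho i) (w i)) * ∏ i, bern (bernArg θ u w i) (v i) =
      ∏ i, g i (w i) := fun w => Finset.prod_mul_distrib.symm
  simp_rw [h1]
  have h2 : ∑ w : State p, ∏ i, g i (w i) = ∏ i, ∑ s, g i s := by
    rw [Finset.prod_univ_sum, Fintype.piFinset_univ]
  rw [h2]
  refine Finset.prod_congr rfl fun i _ => ?_
  have hq : oneProb θ u i = ∑ j, θ.A i j * val (u j) + ∑ j, θ.Aneg i j * (1 - val (u j)) +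
      θ.b i * θ.rho i := by
    simp only [oneProb, Params.Abar, Params.cbar, Matrix.sub_apply, sub_mul, mul_sub, mul_one,
      Finset.sum_sub_distrib]
    ring
  rw [hq]
  cases hv : v i <;> simp [g, bern, val, hv] <;> ring

lemma sum_trans_eq_one {p : ℕ} (θ : Params p) (u : State p) : ∑ v, trans θ u v = 1 := by
  have h2 : ∑ v, trans θ u v = ∏ i, ∑ s, bern (oneProb θ u i) s := by
    rw [Finset.prod_univ_sum, Fintype.piFinset_univ]; rfl
  rw [h2]
  simp only [sum_bern, Finset.prod_const_one]

lemma sum_trans_mul_ite {p : ℕ} (θ : Params p) (u : State p) (i : Fin p) :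
    ∑ v, trans θ u v * (if v i = true then 1 else 0) = oneProb θ u i := by
  -- The indicator is absorbed into the `i`-th factor; every other factor sums to `1`.
  let g : Fin p → Bool → ℝ := fun j s =>
    bern (oneProb θ u j) s * (if j = i then (if s = true then 1 else 0) else 1)
  have h1 : ∀ v : State p, trans θ u v * (if v i = true then 1 else 0) = ∏ j, g j (v j) := by
    intro v
    rw [Finset.prod_mul_distrib, Finset.prod_ite_eq' Finset.univ i]
    simp [trans]
  simp_rw [h1]
  have h2 : ∑ v : State p, ∏ j, g j (v j) = ∏ j, ∑ s, g j s := by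
    rw [Finset.prod_univ_sum, Fintype.piFinset_univ]
  rw [h2, Finset.prod_eq_single i]
  · simp [g, bern]
  · intro j _ hj
    simp [g, hj, bern]
  · simp

section ParamSpace

variable {p : ℕ} {bmin rhomin rhomax : ℝ} {θ : Params p}

/-- The influences contribute `∑ (a u + ã (1 - u)) ≥ 0`, and the noise adds the strictly positive
`b_i ρ_i`. Symmetrically, the distance to `1` is at least `b_i (1 - ρ_i)`. -/
lemma oneProb_pos (hb₀ : 0 < bmin) (hr₀ : 0 < rhomin)
    (hθ : θ ∈ paramSpace p bmin rhomin rhomax) (u : State p) (i : Fin p) :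
    0 < oneProb θ u i := by
  obtain ⟨-, hb, hr, -, ha⟩ := hθ i
  have h1 : 0 < θ.b i * θ.rho i := mul_pos (by linarith) (by linarith)
  have h2 : 0 ≤ ∑ j, (θ.Abar i j * val (u j) + θ.Aneg i j) := by
    refine Finset.sum_nonneg fun j _ => ?_
    obtain ⟨h3, h4, -⟩ := ha j
    simp only [Params.Abar, Matrix.sub_apply]
    nlinarith [mul_nonneg h3 (val_nonneg (u j)),
      mul_nonneg h4 (sub_nonneg.2 (val_le_one (u j)))]
  rw [Finset.sum_add_distrib] at h2
  simp only [oneProb, Params.cbar]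
  linarith

lemma oneProb_lt_one (hb₀ : 0 < bmin) (hr₁ : rhomax < 1)
    (hθ : θ ∈ paramSpace p bmin rhomin rhomax) (u : State p) (i : Fin p) :
    oneProb θ u i < 1 := by
  obtain ⟨hs, hb, -, hr, ha⟩ := hθ i
  have h1 : 0 < θ.b i * (1 - θ.rho i) := mul_pos (by linarith) (by linarith)
  have h2 : ∑ j, (θ.Abar i j * val (u j) + θ.Aneg i j) ≤ ∑ j, (θ.A i j + θ.Aneg i j) := by
    refine Finset.sum_le_sum fun j _ => ?_
    obtain ⟨h3, h4, -⟩ := ha j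
    simp only [Params.Abar, Matrix.sub_apply]
    nlinarith [mul_nonneg h4 (val_nonneg (u j)),
      mul_nonneg h3 (sub_nonneg.2 (val_le_one (u j)))]
  rw [Finset.sum_add_distrib] at h2
  simp only [oneProb, Params.cbar]
  linarith

lemma trans_pos (hb₀ : 0 < bmin) (hr₀ : 0 < rhomin) (hr₁ : rhomax < 1)
    (hθ : θ ∈ paramSpace p bmin rhomin rhomax) (u v : State p) : 0 < trans θ u v := by
  refine Finset.prod_pos fun i _ => ?_
  have h1 := oneProb_pos hb₀ hr₀ hθ u i
  have h2 := oneProb_lt_one hb₀ hr₁ hθ u i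
  unfold bern
  split_ifs <;> linarith

end ParamSpace

/-! ### The Markov property -/

/-- Expectation of a function of a finite-valued random variable. -/
lemma integral_comp_eq_sum {Ω F : Type*} [MeasurableSpace Ω] {μ : Measure Ω} [IsFiniteMeasure μ]
    [Fintype F] [MeasurableSpace F] [MeasurableSingletonClass F] {Y : Ω → F} (hY : Measurable Y)
    (H : F → ℝ) : ∫ ω, H (Y ω) ∂μ = ∑ y, μ.real (Y ⁻¹' {y}) * H y := by
  have h : ∫ ω, H (Y ω) ∂μ = ∫ y, H y ∂(μ.map Y) :=
    (integral_map hY.aemeasurable (measurable_of_finite H).aestronglyMeasurable).symm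
  rw [h, integral_fintype Integrable.of_finite]
  refine Finset.sum_congr rfl fun y _ => ?_
  rw [map_measureReal_apply hY (measurableSet_singleton y), smul_eq_mul]

lemma measureReal_eq_sum_inter {Ω F : Type*} [MeasurableSpace Ω] {μ : Measure Ω}
    [IsFiniteMeasure μ] [Fintype F] [MeasurableSpace F] [MeasurableSingletonClass F] {Y : Ω → F}
    (hY : Measurable Y) (S : Set Ω) :
    μ.real S = ∑ y, μ.real (S ∩ Y ⁻¹' {y}) := by
  classical
  have h := sum_measureReal_preimage_singleton (μ := μ.restrict S) (Finset.univ : Finset F)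
    (f := Y) (fun y _ => hY (measurableSet_singleton y))
  simp only [Finset.coe_univ, Set.preimage_univ] at h
  rw [measureReal_restrict_apply_univ] at h
  rw [← h]
  refine Finset.sum_congr rfl fun y _ => ?_
  rw [measureReal_restrict_apply (hY (measurableSet_singleton y)), Set.inter_comm]

/-- The event that `X` follows `x` up to time `n`. -/
def pathEvent {p : ℕ} {Ω : Type*} (X : ℕ → Ω → State p) (x : ℕ → State p) (n : ℕ) : Set Ω :=
  {ω | ∀ k ≤ n, X k ω = x k}

/-- The sequence that starts with `y` and continues with the constant `v`. -/
def extend {p n : ℕ} (y : Fin n → State p) (v : State p) : ℕ → State p :=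
  fun k => if h : k < n then y ⟨k, h⟩ else v

lemma extend_of_lt {p n : ℕ} (y : Fin n → State p) (v : State p) {k : ℕ} (h : k < n) :
    extend y v k = y ⟨k, h⟩ := dif_pos h

lemma extend_self {p n : ℕ} (y : Fin n → State p) (v : State p) : extend y v n = v :=
  dif_neg (lt_irrefl n)

/-- A cylinder reads the noise only from time `1` on, hence the shift `k - 1`. As `y` varies, these
cylinders partition the path event of `X`. -/
lemma cylinder_extend {p : ℕ} {Ω : Type*} (X W : ℕ → Ω → State p)
    (x : ℕ → State p) (n : ℕ) (y : Fin n → State p) (v : State p) :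
    cylinder X W x (fun k => extend y v (k - 1)) n =
      pathEvent X x n ∩ (fun ω (k : Fin n) => W (k + 1) ω) ⁻¹' {y} := by
  ext ω
  simp only [cylinder, pathEvent, Set.mem_ofPred_eq, Set.mem_inter_iff, Set.mem_preimage,
    Set.mem_singleton_iff, Nat.add_sub_cancel, funext_iff (f := fun k : Fin n => W (k + 1) ω)]
  refine and_congr_right fun _ => ⟨fun h k => ?_, fun h k hk => ?_⟩
  · rw [h k k.2, extend_of_lt y v k.2]
  · rw [extend_of_lt y v hk, ← h ⟨k, hk⟩]

lemma cylinder_extend_succ {p : ℕ} {Ω : Type*} (X W : ℕ → Ω → State p)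
    (x : ℕ → State p) (n : ℕ) (y : Fin n → State p) (v : State p) :
    cylinder X W x (fun k => extend y v (k - 1)) (n + 1) =
      pathEvent X x (n + 1) ∩
        (fun ω => ((fun (k : Fin n) => W (k + 1) ω), W (n + 1) ω)) ⁻¹' {(y, v)} := by
  ext ω
  simp only [cylinder, pathEvent, Set.mem_ofPred_eq, Set.mem_inter_iff, Set.mem_preimage,
    Set.mem_singleton_iff, Nat.add_sub_cancel, Prod.mk.injEq,
    funext_iff (f := fun k : Fin n => W (k + 1) ω)]
  refine and_congr_right fun _ => ⟨fun h => ⟨fun k => ?_, ?_⟩, fun h k hk => ?_⟩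
  · rw [h k (by omega), extend_of_lt y v k.2]
  · rw [h n (by omega), extend_self]
  · rcases Nat.lt_succ_iff_lt_or_eq.1 hk with hk | rfl
    · rw [extend_of_lt y v hk, ← h.1 ⟨k, hk⟩]
    · rw [extend_self, h.2]

lemma IsGenericBAR.measurable_transition {p : ℕ} {Ω : Type*} [MeasurableSpace Ω]
    {μ : Measure Ω} {θ : Params p} {X W : ℕ → Ω → State p} (h : IsGenericBAR θ μ X W)
    (f : State p → State p → ℝ) (k : ℕ) : Measurable fun ω => f (X k ω) (X (k + 1) ω) :=
  (measurable_of_finite (fun z : State p × State p => f z.1 z.2)).comp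
    ((h.measurable_X k).prodMk (h.measurable_X (k + 1)))

section Markov

variable {p : ℕ} {Ω : Type*} [MeasurableSpace Ω] {μ : Measure Ω} [IsProbabilityMeasure μ]
  {θ : Params p} {X W : ℕ → Ω → State p}

lemma IsGenericBAR.measureReal_pathEvent_succ (h : IsGenericBAR θ μ X W) (x : ℕ → State p)
    (n : ℕ) : μ.real (pathEvent X x (n + 1)) =
      μ.real (pathEvent X x n) * trans θ (x n) (x (n + 1)) := by
  have hm1 : Measurable (fun ω (k : Fin n) => W (k + 1) ω) :=
    measurable_pi_lambda _ fun k => h.measurable_W _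
  have hm2 : Measurable (fun ω => ((fun (k : Fin n) => W (k + 1) ω), W (n + 1) ω)) :=
    hm1.prodMk (h.measurable_W _)
  rw [measureReal_eq_sum_inter hm2, measureReal_eq_sum_inter hm1 (pathEvent X x n),
    Fintype.sum_prod_type, Finset.sum_mul]
  refine Finset.sum_congr rfl fun y _ => ?_
  rw [← sum_noise_eq_trans, Finset.mul_sum]
  refine Finset.sum_congr rfl fun v _ => ?_
  rw [← cylinder_extend_succ, h.law_step, cylinder_extend]
  simp only [Nat.add_sub_cancel, extend_self]
  ring

/-- The Markov property, in integrated form. -/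
lemma IsGenericBAR.integral_mul_step (h : IsGenericBAR θ μ X W) (n : ℕ)
    (G : (ℕ → State p) → ℝ) (hG : ∀ x x' : ℕ → State p, (∀ k ≤ n, x k = x' k) → G x = G x')
    (f : State p → State p → ℝ) :
    ∫ ω, G (fun k => X k ω) * f (X n ω) (X (n + 1) ω) ∂μ =
      ∫ ω, G (fun k => X k ω) * ∑ v, trans θ (X n ω) v * f (X n ω) v ∂μ := by
  have hm1 : Measurable (fun ω (k : Fin (n + 1)) => X k ω) :=
    measurable_pi_lambda _ fun k => h.measurable_X _
  have hm2 : Measurable (fun ω => ((fun (k : Fin (n + 1)) => X k ω), X (n + 1) ω)) :=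
    hm1.prodMk (h.measurable_X _)
  -- `G` sees only times up to `n`, so the path may be replaced by a finite tuple with an arbitrary
  -- continuation, and both expectations become finite sums over paths.
  have hG' : ∀ ω, G (fun k => X k ω) =
      G (extend (fun k : Fin (n + 1) => X k ω) (zeroState p)) := fun ω =>
    hG _ _ fun k hk => by rw [extend_of_lt _ _ (Nat.lt_succ_of_le hk)]
  have e1 := integral_comp_eq_sum (μ := μ) hm2 (fun z : (Fin (n + 1) → State p) × State p =>
    G (extend z.1 (zeroState p)) * f (z.1 (Fin.last n)) z.2)
  have e2 := integral_comp_eq_sum (μ := μ) hm1 (fun z : (Fin (n + 1) → State p) =>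
    G (extend z (zeroState p)) * ∑ v, trans θ (z (Fin.last n)) v * f (z (Fin.last n)) v)
  simp only [← hG', Fin.val_last] at e1 e2
  rw [e1, e2, Fintype.sum_prod_type]
  refine Finset.sum_congr rfl fun y _ => ?_
  rw [Finset.mul_sum, Finset.mul_sum]
  refine Finset.sum_congr rfl fun v _ => ?_
  have p1 : (fun ω => ((fun (k : Fin (n + 1)) => X k ω), X (n + 1) ω)) ⁻¹' {(y, v)} =
      pathEvent X (extend y v) (n + 1) := by
    ext ω
    simp only [pathEvent, Set.mem_ofPred_eq, Set.mem_preimage,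
      Set.mem_singleton_iff, Prod.mk.injEq, funext_iff (f := fun k : Fin (n + 1) => X k ω)]
    refine ⟨fun h k hk => ?_, fun h => ⟨fun k => ?_, ?_⟩⟩
    · rcases Nat.le_succ_iff_eq_or_le.1 hk with rfl | hk
      · rw [extend_self, h.2]
      · rw [extend_of_lt y v (Nat.lt_succ_of_le hk), ← h.1 ⟨k, _⟩]
    · rw [h k k.2.le, extend_of_lt y v k.2]
    · rw [h (n + 1) le_rfl, extend_self]
  have p2 : (fun ω (k : Fin (n + 1)) => X k ω) ⁻¹' {y} = pathEvent X (extend y v) n := by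
    ext ω
    simp only [pathEvent, Set.mem_ofPred_eq, Set.mem_preimage,
      Set.mem_singleton_iff, funext_iff (f := fun k : Fin (n + 1) => X k ω)]
    refine ⟨fun h k hk => ?_, fun h k => ?_⟩
    · rw [extend_of_lt y v (Nat.lt_succ_of_le hk), ← h ⟨k, _⟩]
    · rw [h k (Nat.le_of_lt_succ k.2), extend_of_lt y v k.2]
  rw [p1, p2, h.measureReal_pathEvent_succ, extend_self, extend_of_lt y v (Nat.lt_succ_self n)]
  change _ * trans θ (y (Fin.last n)) v * _ = _
  ring

lemma IsGenericBAR.measureReal_step (h : IsGenericBAR θ μ X W) (k : ℕ) (u : State p)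
    (i : Fin p) : μ.real {ω | X k ω = u ∧ X (k + 1) ω i = true} =
      μ.real {ω | X k ω = u} * oneProb θ u i := by
  classical
  have e := h.integral_mul_step k (fun _ => 1) (fun _ _ _ => rfl)
    (fun x y => if x = u ∧ y i = true then 1 else 0)
  simp only [one_mul] at e
  have hm : MeasurableSet {ω | X k ω = u} := h.measurable_X k (measurableSet_singleton u)
  have hm' : MeasurableSet {ω | X k ω = u ∧ X (k + 1) ω i = true} :=
    hm.inter ((measurable_pi_apply i).comp (h.measurable_X (k + 1)) (measurableSet_singleton true))
  have e1 : (fun ω => if X k ω = u ∧ X (k + 1) ω i = true then (1 : ℝ) else 0) =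
      {ω | X k ω = u ∧ X (k + 1) ω i = true}.indicator 1 := by
    ext ω; simp [Set.indicator_apply]
  have e2 : (fun ω => ∑ v, trans θ (X k ω) v * if X k ω = u ∧ v i = true then (1 : ℝ) else 0) =
      {ω | X k ω = u}.indicator (fun _ => oneProb θ u i) := by
    ext ω
    by_cases hu : X k ω = u
    · simp only [hu, true_and, Set.indicator_apply, Set.mem_ofPred_eq, if_true]
      exact sum_trans_mul_ite θ u i
    · simp [hu]
  rw [e1, e2, integral_indicator_one hm', integral_indicator_const _ hm, smul_eq_mul] at e
  exact e

/-! ### The strong law for centered functions of transitions -/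

/-- The increments are centered given the past, so the cross term vanishes and each step adds at
most `C ^ 2`. -/
lemma IsGenericBAR.second_moment_le (h : IsGenericBAR θ μ X W) {f : State p → State p → ℝ}
    (hf : ∀ u, ∑ v, trans θ u v * f u v = 0) {C : ℝ} (hC : ∀ u v, |f u v| ≤ C) (n : ℕ) :
    ∫ ω, (∑ k ∈ Finset.range n, f (X k ω) (X (k + 1) ω)) ^ 2 ∂μ ≤ C ^ 2 * n := by
  have hC0 : 0 ≤ C := (abs_nonneg _).trans (hC (zeroState p) (zeroState p))
  have hmD := h.measurable_transition f
  have hmM : ∀ n, Measurable fun ω => ∑ k ∈ Finset.range n, f (X k ω) (X (k + 1) ω) :=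
    fun n => Finset.measurable_fun_sum _ fun k _ => hmD k
  have hbM : ∀ n ω, |∑ k ∈ Finset.range n, f (X k ω) (X (k + 1) ω)| ≤ n * C := by
    intro n ω
    refine (Finset.abs_sum_le_sum_abs _ _).trans ?_
    refine (Finset.sum_le_sum fun k _ => hC _ _).trans ?_
    simp
  induction n with
  | zero => simp
  | succ n ih =>
    have i1 : Integrable (fun ω => (∑ k ∈ Finset.range n, f (X k ω) (X (k + 1) ω)) ^ 2) μ := by
      refine Integrable.of_bound ((hmM n).pow_const 2).aestronglyMeasurable ((n * C) ^ 2)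
        (Eventually.of_forall fun ω => ?_)
      rw [Real.norm_eq_abs, abs_pow]
      exact pow_le_pow_left₀ (abs_nonneg _) (hbM n ω) 2
    have i2 : Integrable (fun ω => (∑ k ∈ Finset.range n, f (X k ω) (X (k + 1) ω)) *
        f (X n ω) (X (n + 1) ω)) μ := by
      refine Integrable.of_bound ((hmM n).mul (hmD n)).aestronglyMeasurable ((n * C) * C)
        (Eventually.of_forall fun ω => ?_)
      rw [Real.norm_eq_abs, abs_mul]
      exact mul_le_mul (hbM n ω) (hC _ _) (abs_nonneg _) (by positivity)
    have b3 : ∀ ω, f (X n ω) (X (n + 1) ω) ^ 2 ≤ C ^ 2 := fun ω => by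
      rw [← sq_abs]; exact pow_le_pow_left₀ (abs_nonneg _) (hC _ _) 2
    have i3 : Integrable (fun ω => f (X n ω) (X (n + 1) ω) ^ 2) μ := by
      refine Integrable.of_bound ((hmD n).pow_const 2).aestronglyMeasurable (C ^ 2)
        (Eventually.of_forall fun ω => ?_)
      rw [Real.norm_eq_abs, abs_of_nonneg (sq_nonneg _)]
      exact b3 ω
    have orth : ∫ ω, (∑ k ∈ Finset.range n, f (X k ω) (X (k + 1) ω)) *
        f (X n ω) (X (n + 1) ω) ∂μ = 0 := by
      have e := h.integral_mul_step n
        (fun x => ∑ k ∈ Finset.range n, f (x k) (x (k + 1))) (fun x x' hx => by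
          refine Finset.sum_congr rfl fun k hk => ?_
          have := Finset.mem_range.1 hk
          rw [hx k (by omega), hx (k + 1) (by omega)]) f
      rw [e]
      simp [hf]
    have i3le : ∫ ω, f (X n ω) (X (n + 1) ω) ^ 2 ∂μ ≤ C ^ 2 := by
      have := integral_mono i3 (integrable_const (C ^ 2)) b3
      simpa using this
    have e : ∀ ω, (∑ k ∈ Finset.range (n + 1), f (X k ω) (X (k + 1) ω)) ^ 2 =
        (∑ k ∈ Finset.range n, f (X k ω) (X (k + 1) ω)) ^ 2 +
        2 * ((∑ k ∈ Finset.range n, f (X k ω) (X (k + 1) ω)) * f (X n ω) (X (n + 1) ω)) +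
        f (X n ω) (X (n + 1) ω) ^ 2 := fun ω => by
      rw [Finset.sum_range_succ]; ring
    simp_rw [e]
    rw [integral_add (by exact i1.add (i2.const_mul 2)) i3, integral_add i1 (i2.const_mul 2),
      integral_const_mul, orth]
    push_cast
    linarith

/-- A sequence of random variables whose second moments are summable tends to zero. -/
lemma ae_tendsto_zero_of_sum_second_moment {Ω : Type*} [MeasurableSpace Ω] {μ : Measure Ω}
    {Z : ℕ → Ω → ℝ} (hm : ∀ n, Measurable (Z n)) (hi : ∀ n, Integrable (fun ω => Z n ω ^ 2) μ)
    {a : ℕ → ℝ} (ha : Summable a) (hle : ∀ n, ∫ ω, Z n ω ^ 2 ∂μ ≤ a n) :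
    ∀ᵐ ω ∂μ, Tendsto (fun n => Z n ω) atTop (𝓝 0) := by
  have hm2 : ∀ n, Measurable fun ω => ENNReal.ofReal (Z n ω ^ 2) := fun n =>
    ((hm n).pow_const 2).ennreal_ofReal
  -- A series of nonnegative terms with finite expectation converges almost surely, so its terms
  -- tend to zero.
  have hfin : ∫⁻ ω, ∑' n, ENNReal.ofReal (Z n ω ^ 2) ∂μ ≠ ⊤ := by
    rw [lintegral_tsum fun n => (hm2 n).aemeasurable]
    refine ne_top_of_le_ne_top ha.tsum_ofReal_ne_top (ENNReal.tsum_le_tsum fun n => ?_)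
    rw [← ofReal_integral_eq_lintegral_ofReal (hi n) (Eventually.of_forall fun ω => sq_nonneg _)]
    exact ENNReal.ofReal_le_ofReal (hle n)
  filter_upwards [ae_lt_top (Measurable.tsum hm2) hfin] with ω hω
  have h0 := ENNReal.tendsto_atTop_zero_of_tsum_ne_top hω.ne
  have h1 := (ENNReal.tendsto_toReal ENNReal.zero_ne_top).comp h0
  have h2 : Tendsto (fun n => Z n ω ^ 2) atTop (𝓝 0) := by
    refine h1.congr fun n => ?_
    simp [ENNReal.toReal_ofReal (sq_nonneg (Z n ω))]
  have h3 := h2.sqrt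
  simp only [Real.sqrt_sq_eq_abs, Real.sqrt_zero] at h3
  exact (tendsto_zero_iff_abs_tendsto_zero _).2 h3

/-- Averages of a bounded sequence converge to zero as soon as they do along the squares. -/
lemma tendsto_average_of_squares {d : ℕ → ℝ} {C : ℝ} (hC : ∀ k, |d k| ≤ C)
    (hsq : Tendsto (fun n : ℕ => (∑ k ∈ Finset.range ((n + 1) ^ 2), d k) / ((n + 1) ^ 2 : ℕ))
      atTop (𝓝 0)) :
    Tendsto (fun n : ℕ => (∑ k ∈ Finset.range n, d k) / n) atTop (𝓝 0) := by
  -- Adding `C` to each term makes the partial sums monotone, so they can be interpolated between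
  -- consecutive squares, whose ratio tends to `1`.
  have hmono : Monotone fun n : ℕ => ∑ k ∈ Finset.range n, (d k + C) := by
    refine monotone_nat_of_le_succ fun n => ?_
    rw [Finset.sum_range_succ]
    have := neg_le_of_abs_le (hC n)
    linarith
  have hdiv : ∀ n : ℕ, n ≠ 0 → (∑ k ∈ Finset.range n, (d k + C)) / n =
      (∑ k ∈ Finset.range n, d k) / n + C := fun n hn => by
    have : (n : ℝ) ≠ 0 := Nat.cast_ne_zero.2 hn
    rw [Finset.sum_add_distrib, Finset.sum_const, Finset.card_range, nsmul_eq_mul]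
    field_simp
  have key := tendsto_div_of_monotone_of_exists_subseq_tendsto_div _ C hmono (fun a ha => by
    refine ⟨fun n => (n + 1) ^ 2, ?_, ?_, ?_⟩
    · have h1 : Tendsto (fun n : ℕ => (1 + 1 / ((n : ℝ) + 1)) ^ 2) atTop (𝓝 ((1 + 0) ^ 2)) :=
        (tendsto_one_div_add_atTop_nhds_zero_nat.const_add 1).pow 2
      have h2 := h1.eventually_lt_const (u := a) (by simpa using ha)
      filter_upwards [h2] with n hn
      have hp : (0 : ℝ) < (n : ℝ) + 1 := by positivity
      have h3 : (1 + 1 / ((n : ℝ) + 1)) ^ 2 * ((n : ℝ) + 1) ^ 2 = ((n : ℝ) + 1 + 1) ^ 2 := by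
        field_simp
      push_cast
      rw [← h3]
      exact mul_le_mul_of_nonneg_right hn.le (by positivity)
    · exact (tendsto_pow_atTop two_ne_zero).comp (tendsto_add_atTop_nat 1)
    · have h1 := hsq.add_const C
      rw [zero_add] at h1
      exact h1.congr fun n => (hdiv _ (by positivity)).symm)
  have h2 := key.sub_const C
  rw [sub_self] at h2
  refine h2.congr' ?_
  filter_upwards [eventually_ne_atTop 0] with n hn
  rw [hdiv n hn]; ring

lemma IsGenericBAR.ae_tendsto_average (h : IsGenericBAR θ μ X W) {f : State p → State p → ℝ}
    (hf : ∀ u, ∑ v, trans θ u v * f u v = 0) :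
    ∀ᵐ ω ∂μ, Tendsto (fun n : ℕ => (∑ k ∈ Finset.range n, f (X k ω) (X (k + 1) ω)) / n)
      atTop (𝓝 0) := by
  obtain ⟨C, hC⟩ : ∃ C, ∀ u v, |f u v| ≤ C := by
    refine ⟨∑ u, ∑ v, |f u v|, fun u v => ?_⟩
    refine (Finset.single_le_sum (f := fun v => |f u v|) (fun _ _ => abs_nonneg _)
      (Finset.mem_univ v)).trans ?_
    exact Finset.single_le_sum (f := fun u => ∑ v, |f u v|)
      (fun _ _ => Finset.sum_nonneg fun _ _ => abs_nonneg _) (Finset.mem_univ u)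
  have hmM : ∀ n, Measurable fun ω => ∑ k ∈ Finset.range n, f (X k ω) (X (k + 1) ω) :=
    fun n => Finset.measurable_fun_sum _ fun k _ => h.measurable_transition f k
  have hs : Summable fun n : ℕ => C ^ 2 * (1 / ((n : ℝ) + 1) ^ 2) := by
    refine Summable.mul_left _ ?_
    have := (summable_nat_add_iff 1).2 (Real.summable_one_div_nat_pow.2 one_lt_two)
    simpa using this
  -- At time `(n+1)²` the average has second moment at most `C² / (n+1)²`, which is summable.
  have key := ae_tendsto_zero_of_sum_second_moment (μ := μ)
    (Z := fun n ω => (∑ k ∈ Finset.range ((n + 1) ^ 2), f (X k ω) (X (k + 1) ω)) /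
      ((n + 1) ^ 2 : ℕ)) (fun n => (hmM _).div_const _) (fun n => by
        refine Integrable.of_bound (((hmM _).div_const _).pow_const 2).aestronglyMeasurable
          (C ^ 2) (Eventually.of_forall fun ω => ?_)
        rw [Real.norm_eq_abs, abs_pow]
        refine pow_le_pow_left₀ (abs_nonneg _) ?_ 2
        rw [abs_div, Nat.abs_cast, div_le_iff₀ (by positivity)]
        refine (Finset.abs_sum_le_sum_abs _ _).trans ?_
        refine (Finset.sum_le_sum fun k _ => hC _ _).trans ?_
        simp [mul_comm]) hs (fun n => by
        simp_rw [div_pow]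
        rw [integral_div, div_le_iff₀ (by positivity)]
        refine (h.second_moment_le hf hC _).trans (le_of_eq ?_)
        push_cast
        field_simp)
  filter_upwards [key] with ω hω
  exact tendsto_average_of_squares (fun k => hC _ _) hω

end Markov

end BAR

namespace BAR

/-! ### The reparametrization -/

/-- Nonnegative `a`, `ã` with `a ã = 0` are the positive and negative parts of `a - ã`; the rest is
arithmetic, with division by `b_i > 0`. -/
lemma recover_Abar_cbar {p : ℕ} {bmin rhomin rhomax : ℝ} (hb₀ : 0 < bmin) {θ : Params p}
    (hθ : θ ∈ paramSpace p bmin rhomin rhomax) : recover θ.Abar θ.cbar = θ := by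
  have hA : ∀ i j, max (θ.Abar i j) 0 = θ.A i j := fun i j => by
    obtain ⟨-, -, -, -, ha⟩ := hθ i
    obtain ⟨h1, h2, h3⟩ := ha j
    rcases mul_eq_zero.1 h3 with h | h <;> simp [Params.Abar, h, h1, h2]
  have hAneg : ∀ i j, max (-θ.Abar i j) 0 = θ.Aneg i j := fun i j => by
    obtain ⟨-, -, -, -, ha⟩ := hθ i
    obtain ⟨h1, h2, h3⟩ := ha j
    rcases mul_eq_zero.1 h3 with h | h <;> simp [Params.Abar, h, h1, h2]
  have hb : ∀ i, 1 - ∑ j, (θ.A i j + θ.Aneg i j) = θ.b i := fun i => by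
    linarith [(hθ i).1]
  obtain ⟨A, Aneg, b, rho⟩ := θ
  simp only [recover, hA, hAneg, hb]
  congr 1
  funext i
  have : b i ≠ 0 := (hb₀.trans_le (hθ i).2.1).ne'
  simp only [Params.cbar]
  field_simp
  ring

/-- The only possible discontinuity of `recover` is the division, and its limiting denominator is
`b_i ≥ bmin > 0`. -/
lemma convergesTo_recover {p : ℕ} {bmin rhomin rhomax : ℝ} (hb₀ : 0 < bmin) {θ : Params p}
    (hθ : θ ∈ paramSpace p bmin rhomin rhomax) {M : ℕ → Matrix (Fin p) (Fin p) ℝ}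
    {c : ℕ → Fin p → ℝ} (hM : Tendsto M atTop (𝓝 θ.Abar)) (hc : Tendsto c atTop (𝓝 θ.cbar)) :
    ConvergesTo (fun T => recover (M T) (c T)) θ := by
  have hM' : ∀ i j, Tendsto (fun T => M T i j) atTop (𝓝 (θ.Abar i j)) := fun i j =>
    tendsto_pi_nhds.1 (tendsto_pi_nhds.1 hM i) j
  have hc' := tendsto_pi_nhds.1 hc
  have h1 : ∀ i j, Tendsto (fun T => max (M T i j) 0) atTop (𝓝 (max (θ.Abar i j) 0)) :=
    fun i j => (hM' i j).max tendsto_const_nhds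
  have h2 : ∀ i j, Tendsto (fun T => max (-M T i j) 0) atTop (𝓝 (max (-θ.Abar i j) 0)) :=
    fun i j => (hM' i j).neg.max tendsto_const_nhds
  have h3 : ∀ i, Tendsto (fun T => 1 - ∑ j, (max (M T i j) 0 + max (-M T i j) 0)) atTop
      (𝓝 (1 - ∑ j, (max (θ.Abar i j) 0 + max (-θ.Abar i j) 0))) := fun i =>
    (tendsto_finsetSum _ fun j _ => (h1 i j).add (h2 i j)).const_sub 1
  have hr := recover_Abar_cbar hb₀ hθ
  have hb : ∀ i, 1 - ∑ j, (max (θ.Abar i j) 0 + max (-θ.Abar i j) 0) ≠ 0 := fun i => by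
    have e : (recover θ.Abar θ.cbar).b i = θ.b i := by rw [hr]
    have := hb₀.trans_le (hθ i).2.1
    rw [← e] at this
    exact this.ne'
  have key : ConvergesTo (fun T => recover (M T) (c T)) (recover θ.Abar θ.cbar) :=
    ⟨tendsto_pi_nhds.2 fun i => tendsto_pi_nhds.2 fun j => h1 i j,
      tendsto_pi_nhds.2 fun i => tendsto_pi_nhds.2 fun j => h2 i j,
      tendsto_pi_nhds.2 h3,
      tendsto_pi_nhds.2 fun i =>
        ((hc' i).sub (tendsto_finsetSum _ fun j _ => h2 i j)).div (h3 i) (hb i)⟩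
  rwa [hr] at key

/-! ### Least squares -/

lemma isUnit_gram {m : Type*} [Fintype m] {p : ℕ} {U : Matrix m (Fin p) ℝ} (h : U.rank = p) :
    IsUnit (U.transpose * U) := by
  rw [← Matrix.linearIndependent_rows_iff_isUnit, linearIndependent_iff_card_eq_finrank_span,
    Set.finrank, ← Matrix.rank_eq_finrank_span_row, Matrix.rank_transpose_mul_self, h, Fintype.card_fin]

/-- Pythagoras: the normal equation makes the residual orthogonal to the range of `U`, and `U (a -
a') ≠ 0` because the Gram matrix is injective. -/
lemma sum_sq_lt_of_normal_equation {m : Type*} [Fintype m] {p : ℕ} {U : Matrix m (Fin p) ℝ}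
    (hU : IsUnit (U.transpose * U)) (z : m → ℝ) {a a' : Fin p → ℝ}
    (ha : U.transpose.mulVec (U.mulVec a) = U.transpose.mulVec z) (hne : a' ≠ a) :
    ∑ u, (z u - U.mulVec a u) ^ 2 < ∑ u, (z u - U.mulVec a' u) ^ 2 := by
  set e := z - U.mulVec a with he
  set d := U.mulVec (a - a') with hd
  have h0 : U.transpose.mulVec e = 0 := by rw [he, Matrix.mulVec_sub, ha, sub_self]
  have orth : e ⬝ᵥ d = 0 := by
    rw [hd, Matrix.dotProduct_mulVec, ← Matrix.mulVec_transpose, h0, zero_dotProduct]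
  have hdne : d ≠ 0 := fun h => by
    have h1 : (U.transpose * U).mulVec (a - a') = 0 := by
      rw [← Matrix.mulVec_mulVec, ← hd, h, Matrix.mulVec_zero]
    have h2 := Matrix.mulVec_injective_of_isUnit hU (h1.trans (Matrix.mulVec_zero _).symm)
    exact hne (sub_eq_zero.1 h2).symm
  have hpos : 0 < d ⬝ᵥ d :=
    lt_of_le_of_ne (Finset.sum_nonneg fun u _ => mul_self_nonneg _)
      fun h => hdne (dotProduct_self_eq_zero.1 h.symm)
  have e1 : ∑ u, (z u - U.mulVec a' u) ^ 2 =
      ∑ u, (z u - U.mulVec a u) ^ 2 + 2 * (e ⬝ᵥ d) + d ⬝ᵥ d := by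
    simp only [dotProduct, Finset.mul_sum, ← Finset.sum_add_distrib]
    refine Finset.sum_congr rfl fun u _ => ?_
    simp only [he, hd, Matrix.mulVec_sub, Pi.sub_apply]
    ring
  rw [e1, orth]
  linarith

lemma GoodData.residual_lt {p : ℕ} {x : ℕ → State p} {T : ℕ} (h : GoodData x T) (r : Fin p)
    {a : Fin p → ℝ} (ha : a ≠ AbarHat x T r) :
    residual x T r (AbarHat x T r) < residual x T r a := by
  have hU := isUnit_gram h.2
  refine sum_sq_lt_of_normal_equation hU (fun u => yvec x T r u - cbarHat x T r) ?_ ha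
  have hdet := (Matrix.isUnit_iff_isUnit_det _).1 hU
  rw [Matrix.mulVec_mulVec]
  change ((Umat x T).transpose * Umat x T).mulVec (((Umat x T).transpose * Umat x T)⁻¹.mulVec
    ((Umat x T).transpose.mulVec fun u => yvec x T r u - cbarHat x T r)) = _
  rw [Matrix.mulVec_mulVec, Matrix.mul_nonsing_inv _ hdet, Matrix.one_mulVec]

/-! ### The support-preserving projection -/

section Distance

variable {p : ℕ}

lemma sq_A_le_distSq (θ θ' : Params p) (i j : Fin p) :
    (θ.A i j - θ'.A i j) ^ 2 ≤ distSq θ θ' := by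
  have h1 : (θ.A i j - θ'.A i j) ^ 2 ≤ ∑ i, ∑ j, (θ.A i j - θ'.A i j) ^ 2 :=
    (Finset.single_le_sum (f := fun j => (θ.A i j - θ'.A i j) ^ 2) (fun _ _ => sq_nonneg _)
      (Finset.mem_univ j)).trans (Finset.single_le_sum
      (f := fun i => ∑ j, (θ.A i j - θ'.A i j) ^ 2)
      (fun _ _ => Finset.sum_nonneg fun _ _ => sq_nonneg _) (Finset.mem_univ i))
  have h2 : 0 ≤ ∑ i, ∑ j, (θ.Aneg i j - θ'.Aneg i j) ^ 2 := by positivity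
  have h3 : 0 ≤ ∑ i, (θ.b i - θ'.b i) ^ 2 := by positivity
  have h4 : 0 ≤ ∑ i, (θ.rho i - θ'.rho i) ^ 2 := by positivity
  unfold distSq
  linarith

lemma sq_Aneg_le_distSq (θ θ' : Params p) (i j : Fin p) :
    (θ.Aneg i j - θ'.Aneg i j) ^ 2 ≤ distSq θ θ' := by
  have h1 : (θ.Aneg i j - θ'.Aneg i j) ^ 2 ≤ ∑ i, ∑ j, (θ.Aneg i j - θ'.Aneg i j) ^ 2 :=
    (Finset.single_le_sum (f := fun j => (θ.Aneg i j - θ'.Aneg i j) ^ 2)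
      (fun _ _ => sq_nonneg _) (Finset.mem_univ j)).trans (Finset.single_le_sum
      (f := fun i => ∑ j, (θ.Aneg i j - θ'.Aneg i j) ^ 2)
      (fun _ _ => Finset.sum_nonneg fun _ _ => sq_nonneg _) (Finset.mem_univ i))
  have h2 : 0 ≤ ∑ i, ∑ j, (θ.A i j - θ'.A i j) ^ 2 := by positivity
  have h3 : 0 ≤ ∑ i, (θ.b i - θ'.b i) ^ 2 := by positivity
  have h4 : 0 ≤ ∑ i, (θ.rho i - θ'.rho i) ^ 2 := by positivity
  unfold distSq
  linarith

lemma sq_b_le_distSq (θ θ' : Params p) (i : Fin p) : (θ.b i - θ'.b i) ^ 2 ≤ distSq θ θ' := by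
  have h1 : (θ.b i - θ'.b i) ^ 2 ≤ ∑ i, (θ.b i - θ'.b i) ^ 2 :=
    Finset.single_le_sum (f := fun i => (θ.b i - θ'.b i) ^ 2) (fun _ _ => sq_nonneg _)
      (Finset.mem_univ i)
  have h2 : 0 ≤ ∑ i, ∑ j, (θ.A i j - θ'.A i j) ^ 2 := by positivity
  have h3 : 0 ≤ ∑ i, ∑ j, (θ.Aneg i j - θ'.Aneg i j) ^ 2 := by positivity
  have h4 : 0 ≤ ∑ i, (θ.rho i - θ'.rho i) ^ 2 := by positivity
  unfold distSq
  linarith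

lemma sq_rho_le_distSq (θ θ' : Params p) (i : Fin p) :
    (θ.rho i - θ'.rho i) ^ 2 ≤ distSq θ θ' := by
  have h1 : (θ.rho i - θ'.rho i) ^ 2 ≤ ∑ i, (θ.rho i - θ'.rho i) ^ 2 :=
    Finset.single_le_sum (f := fun i => (θ.rho i - θ'.rho i) ^ 2) (fun _ _ => sq_nonneg _)
      (Finset.mem_univ i)
  have h2 : 0 ≤ ∑ i, ∑ j, (θ.A i j - θ'.A i j) ^ 2 := by positivity
  have h3 : 0 ≤ ∑ i, ∑ j, (θ.Aneg i j - θ'.Aneg i j) ^ 2 := by positivity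
  have h4 : 0 ≤ ∑ i, (θ.b i - θ'.b i) ^ 2 := by positivity
  unfold distSq
  linarith

lemma distSq_nonneg (θ θ' : Params p) : 0 ≤ distSq θ θ' := by
  unfold distSq; positivity

lemma eq_of_distSq_le_zero {θ θ' : Params p} (h : distSq θ θ' ≤ 0) : θ = θ' := by
  have key : ∀ {s t : ℝ}, (s - t) ^ 2 ≤ distSq θ θ' → s = t := fun hst =>
    sub_eq_zero.1 (pow_eq_zero_iff two_ne_zero |>.1 (le_antisymm (hst.trans h) (sq_nonneg _)))
  have h1 := fun i j => key (sq_A_le_distSq θ θ' i j)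
  have h2 := fun i j => key (sq_Aneg_le_distSq θ θ' i j)
  have h3 := fun i => key (sq_b_le_distSq θ θ' i)
  have h4 := fun i => key (sq_rho_le_distSq θ θ' i)
  obtain ⟨A, Aneg, b, rho⟩ := θ
  obtain ⟨A', Aneg', b', rho'⟩ := θ'
  simp only [Params.mk.injEq]
  exact ⟨Matrix.ext h1, Matrix.ext h2, funext h3, funext h4⟩

/-- The midpoint of two parameter tuples. -/
noncomputable def mid (θ θ' : Params p) : Params p where
  A := Matrix.of fun i j => (θ.A i j + θ'.A i j) / 2
  Aneg := Matrix.of fun i j => (θ.Aneg i j + θ'.Aneg i j) / 2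
  b := fun i => (θ.b i + θ'.b i) / 2
  rho := fun i => (θ.rho i + θ'.rho i) / 2

/-- The parallelogram identity, the source of uniqueness of the projection. -/
lemma distSq_mid (θ θ₁ θ₂ : Params p) :
    distSq θ (mid θ₁ θ₂) = (distSq θ θ₁ + distSq θ θ₂) / 2 - distSq θ₁ θ₂ / 4 := by
  have key : ∀ s t t' : ℝ, (s - (t + t') / 2) ^ 2 =
      (1 / 2) * (s - t) ^ 2 + (1 / 2) * (s - t') ^ 2 - (1 / 4) * (t - t') ^ 2 :=
    fun s t t' => by ring
  simp only [distSq, mid, Matrix.of_apply, key, Finset.sum_sub_distrib, Finset.sum_add_distrib,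
    ← Finset.mul_sum]
  ring

lemma ConvergesTo.tendsto_distSq {θ : ℕ → Params p} {θ₀ : Params p} (h : ConvergesTo θ θ₀) :
    Tendsto (fun T => distSq (θ T) θ₀) atTop (𝓝 0) := by
  obtain ⟨h1, h2, h3, h4⟩ := h
  have key : ∀ {s : ℕ → ℝ} {t : ℝ}, Tendsto s atTop (𝓝 t) →
      Tendsto (fun T => (s T - t) ^ 2) atTop (𝓝 0) := fun {s t} hs => by
    simpa using (hs.sub_const t).pow 2
  have e1 := tendsto_finsetSum Finset.univ fun i _ => tendsto_finsetSum Finset.univ fun j _ =>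
    key (tendsto_pi_nhds.1 (tendsto_pi_nhds.1 h1 i) j)
  have e2 := tendsto_finsetSum Finset.univ fun i _ => tendsto_finsetSum Finset.univ fun j _ =>
    key (tendsto_pi_nhds.1 (tendsto_pi_nhds.1 h2 i) j)
  have e3 := tendsto_finsetSum Finset.univ fun i _ => key (tendsto_pi_nhds.1 h3 i)
  have e4 := tendsto_finsetSum Finset.univ fun i _ => key (tendsto_pi_nhds.1 h4 i)
  simpa [distSq] using ((e1.add e2).add e3).add e4

lemma ConvergesTo.of_distSq {θ η : ℕ → Params p} {θ₀ : Params p} (h : ConvergesTo θ θ₀)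
    (hd : Tendsto (fun T => distSq (θ T) (η T)) atTop (𝓝 0)) : ConvergesTo η θ₀ := by
  obtain ⟨h1, h2, h3, h4⟩ := h
  have key : ∀ {s s' : ℕ → ℝ} {t : ℝ}, Tendsto s atTop (𝓝 t) →
      (∀ T, (s T - s' T) ^ 2 ≤ distSq (θ T) (η T)) → Tendsto s' atTop (𝓝 t) :=
    fun {s s' t} hs hle => by
      have e1 := (squeeze_zero (fun T => sq_nonneg _) hle hd).sqrt
      simp only [Real.sqrt_sq_eq_abs, Real.sqrt_zero] at e1
      have e2 := (tendsto_zero_iff_abs_tendsto_zero _).2 e1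
      simpa using hs.sub e2
  exact ⟨tendsto_pi_nhds.2 fun i => tendsto_pi_nhds.2 fun j =>
      key (tendsto_pi_nhds.1 (tendsto_pi_nhds.1 h1 i) j) fun T => sq_A_le_distSq _ _ i j,
    tendsto_pi_nhds.2 fun i => tendsto_pi_nhds.2 fun j =>
      key (tendsto_pi_nhds.1 (tendsto_pi_nhds.1 h2 i) j) fun T => sq_Aneg_le_distSq _ _ i j,
    tendsto_pi_nhds.2 fun i => key (tendsto_pi_nhds.1 h3 i) fun T => sq_b_le_distSq _ _ i,
    tendsto_pi_nhds.2 fun i => key (tendsto_pi_nhds.1 h4 i) fun T => sq_rho_le_distSq _ _ i⟩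

end Distance

/-! ### Existence, uniqueness and consistency of the projection -/

section Projection

variable {p : ℕ} {bmin rhomin rhomax : ℝ} {θ : Params p}

lemma supportSpace_nonempty (hb₁ : bmin ≤ 1) (hr : rhomin ≤ rhomax) :
    (supportSpace bmin rhomin rhomax θ).Nonempty :=
  ⟨⟨0, 0, fun _ => 1, fun _ => rhomin⟩, fun i => ⟨by simp, hb₁, le_rfl, hr, by simp⟩,
    by simp, by simp⟩

/-- The condition `a ã = 0` is not convex by itself. Under `hθ`, the support constraints already
force one factor to vanish at each entry, and the remaining constraints are preserved by averaging.
-/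
lemma mid_mem_supportSpace (hθ : ∀ i j, θ.A i j = 0 ∨ θ.Aneg i j = 0) {θ₁ θ₂ : Params p}
    (h₁ : θ₁ ∈ supportSpace bmin rhomin rhomax θ) (h₂ : θ₂ ∈ supportSpace bmin rhomin rhomax θ) :
    mid θ₁ θ₂ ∈ supportSpace bmin rhomin rhomax θ := by
  obtain ⟨p₁, a₁, n₁⟩ := h₁
  obtain ⟨p₂, a₂, n₂⟩ := h₂
  have ha : ∀ i j, θ.A i j = 0 → (mid θ₁ θ₂).A i j = 0 := fun i j h => by
    simp [mid, a₁ i j h, a₂ i j h]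
  have hn : ∀ i j, θ.Aneg i j = 0 → (mid θ₁ θ₂).Aneg i j = 0 := fun i j h => by
    simp [mid, n₁ i j h, n₂ i j h]
  refine ⟨fun i => ?_, ha, hn⟩
  obtain ⟨s₁, b₁, r₁, r₁', c₁⟩ := p₁ i
  obtain ⟨s₂, b₂, r₂, r₂', c₂⟩ := p₂ i
  refine ⟨?_, ?_, ?_, ?_, fun j => ⟨?_, ?_, ?_⟩⟩
  · simp only [mid, Matrix.of_apply, ← add_div, ← Finset.sum_div]
    rw [Finset.sum_add_distrib] at s₁ s₂ ⊢
    rw [Finset.sum_add_distrib, Finset.sum_add_distrib]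
    linarith
  · simp only [mid]; linarith
  · simp only [mid]; linarith
  · simp only [mid]; linarith
  · have := (c₁ j).1; have := (c₂ j).1
    simp only [mid, Matrix.of_apply]; linarith
  · have := (c₁ j).2.1; have := (c₂ j).2.1
    simp only [mid, Matrix.of_apply]; linarith
  · rcases hθ i j with h | h
    · rw [ha i j h, zero_mul]
    · rw [hn i j h, mul_zero]

/-- Parameter tuples as elements of a product space. -/
def ofProd (z : (Fin p → Fin p → ℝ) × (Fin p → Fin p → ℝ) × (Fin p → ℝ) × (Fin p → ℝ)) :
    Params p :=
  ⟨z.1, z.2.1, z.2.2.1, z.2.2.2⟩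

lemma isCompact_supportSpace (hb₀ : 0 ≤ bmin) (hr₀ : 0 ≤ rhomin) (hr₁ : rhomax ≤ 1) :
    IsCompact (ofProd ⁻¹' supportSpace bmin rhomin rhomax θ) := by
  -- Nonnegativity and the row sums equal to `1` confine all weights to `[0,1]`, so the set is a
  -- closed part of a unit cube.
  refine IsCompact.of_isClosed_subset (isCompact_Icc (a := 0) (b := 1)) ?_ ?_
  · have himp : ∀ {Z : Type} [TopologicalSpace Z] {P : Prop} {g : Z → ℝ}, Continuous g →
        IsClosed {z | P → g z = 0} := fun {Z _ P g} hg => by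
      by_cases hP : P
      · simpa [hP] using isClosed_eq hg continuous_const
      · simp [hP]
    have c1 : ∀ i j, Continuous fun z : (Fin p → Fin p → ℝ) × (Fin p → Fin p → ℝ) ×
      (Fin p → ℝ) × (Fin p → ℝ) => (ofProd z).A i j := fun i j => by
        simp only [ofProd]; fun_prop
    have c2 : ∀ i j, Continuous fun z : (Fin p → Fin p → ℝ) × (Fin p → Fin p → ℝ) ×
      (Fin p → ℝ) × (Fin p → ℝ) => (ofProd z).Aneg i j := fun i j => by
        simp only [ofProd]; fun_prop
    have c3 : ∀ i, Continuous fun z : (Fin p → Fin p → ℝ) × (Fin p → Fin p → ℝ) ×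
      (Fin p → ℝ) × (Fin p → ℝ) => (ofProd z).b i := fun i => by
        simp only [ofProd]; fun_prop
    have c4 : ∀ i, Continuous fun z : (Fin p → Fin p → ℝ) × (Fin p → Fin p → ℝ) ×
      (Fin p → ℝ) × (Fin p → ℝ) => (ofProd z).rho i := fun i => by
        simp only [ofProd]; fun_prop
    have hall : ∀ {Z ι : Type} [TopologicalSpace Z] {P : ι → Z → Prop},
        (∀ i, IsClosed {z | P i z}) → IsClosed {z | ∀ i, P i z} := fun {Z ι _ P} hP => by
      rw [Set.ofPred_forall]; exact isClosed_iInter hP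
    refine IsClosed.and (hall fun i => ?_) (IsClosed.and (hall fun i => hall fun j => himp (c1 i j))
      (hall fun i => hall fun j => himp (c2 i j)))
    refine IsClosed.and (isClosed_eq (by fun_prop) continuous_const) (IsClosed.and
      (isClosed_le continuous_const (c3 i)) (IsClosed.and (isClosed_le continuous_const (c4 i))
      (IsClosed.and (isClosed_le (c4 i) continuous_const) (hall fun j => IsClosed.and
      (isClosed_le continuous_const (c1 i j)) (IsClosed.and (isClosed_le continuous_const (c2 i j))
      (isClosed_eq ((c1 i j).mul (c2 i j)) continuous_const))))))
  · intro z hz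
    have hz' : ofProd z ∈ paramSpace p bmin rhomin rhomax := hz.1
    have hle : ∀ i j, z.1 i j + z.2.1 i j ≤ 1 - z.2.2.1 i := fun i j => by
      obtain ⟨hs, -, -, -, hc⟩ := hz' i
      have := Finset.single_le_sum (f := fun j => z.1 i j + z.2.1 i j)
        (fun j _ => add_nonneg (hc j).1 (hc j).2.1) (Finset.mem_univ j)
      have hs' : ∑ j, (z.1 i j + z.2.1 i j) + z.2.2.1 i = 1 := hs
      linarith
    have hb : ∀ i, 0 ≤ z.2.2.1 i := fun i => hb₀.trans (hz' i).2.1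
    have hA : ∀ i j, 0 ≤ z.1 i j := fun i j => ((hz' i).2.2.2.2 j).1
    have hN : ∀ i j, 0 ≤ z.2.1 i j := fun i j => ((hz' i).2.2.2.2 j).2.1
    refine ⟨⟨hA, hN, hb, fun i => hr₀.trans (hz' i).2.2.1⟩, fun i j => ?_, fun i j => ?_,
      fun i => ?_, fun i => (hz' i).2.2.2.1.trans hr₁⟩
    · have := hle i j; have := hb i; have := hN i j
      change z.1 i j ≤ 1
      linarith
    · have := hle i j; have := hb i; have := hA i j
      change z.2.1 i j ≤ 1
      linarith
    · have hs : ∑ j, (z.1 i j + z.2.1 i j) + z.2.2.1 i = 1 := (hz' i).1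
      have := Finset.sum_nonneg fun j (_ : j ∈ Finset.univ) => add_nonneg (hA i j) (hN i j)
      change z.2.2.1 i ≤ 1
      linarith

lemma existsUnique_isSupportProjection (hb₀ : 0 ≤ bmin) (hb₁ : bmin ≤ 1) (hr₀ : 0 ≤ rhomin)
    (hr : rhomin ≤ rhomax) (hr₁ : rhomax ≤ 1) (hθ : ∀ i j, θ.A i j = 0 ∨ θ.Aneg i j = 0) :
    ∃! θ', IsSupportProjection bmin rhomin rhomax θ θ' := by
  have hne : (ofProd ⁻¹' supportSpace bmin rhomin rhomax θ).Nonempty := by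
    obtain ⟨θ', h⟩ := supportSpace_nonempty (θ := θ) hb₁ hr
    exact ⟨(θ'.A, θ'.Aneg, θ'.b, θ'.rho), h⟩
  have hcont : Continuous fun z => distSq θ (ofProd z) := by
    simp only [distSq, ofProd]; fun_prop
  obtain ⟨z, hz, hmin⟩ := (isCompact_supportSpace hb₀ hr₀ hr₁).exists_isMinOn hne
    hcont.continuousOn
  refine ⟨ofProd z, ⟨hz, fun θ'' h'' => ?_⟩, fun θ' h' => ?_⟩
  · exact hmin (a := (θ''.A, θ''.Aneg, θ''.b, θ''.rho)) h''
  · have h1 := h'.2 _ (mid_mem_supportSpace hθ h'.1 hz)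
    have h2 : distSq θ (ofProd z) ≤ distSq θ (mid θ' (ofProd z)) := by
      have hm := mid_mem_supportSpace hθ h'.1 hz
      generalize mid θ' (ofProd z) = θ'' at hm
      exact hmin (a := (θ''.A, θ''.Aneg, θ''.b, θ''.rho)) hm
    rw [distSq_mid] at h1 h2
    exact eq_of_distSq_le_zero (by linarith)

lemma recover_A_or_Aneg_eq_zero (M : Matrix (Fin p) (Fin p) ℝ) (c : Fin p → ℝ) (i j : Fin p) :
    (recover M c).A i j = 0 ∨ (recover M c).Aneg i j = 0 := by
  rcases le_total (M i j) 0 with h | h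
  · exact Or.inl (max_eq_right h)
  · exact Or.inr (max_eq_right (neg_nonpos.2 h))

/-- Nonzero entries of `θ` are eventually nonzero in `η T`. Spurious nonzero entries of `η T` do no
harm, since they impose no constraint. -/
lemma ConvergesTo.eventually_mem_supportSpace {η : ℕ → Params p} (h : ConvergesTo η θ)
    (hθ : θ ∈ paramSpace p bmin rhomin rhomax) :
    ∀ᶠ T in atTop, θ ∈ supportSpace bmin rhomin rhomax (η T) := by
  have key : ∀ {s : ℕ → ℝ} {t : ℝ}, Tendsto s atTop (𝓝 t) → ∀ᶠ T in atTop, s T = 0 → t = 0 :=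
    fun {s t} hs => by
      by_cases ht : t = 0
      · exact Eventually.of_forall fun _ _ => ht
      · filter_upwards [hs.eventually_ne ht] with T hT h0
        exact absurd h0 hT
  have e1 := eventually_all.2 fun i => eventually_all.2 fun j =>
    key (tendsto_pi_nhds.1 (tendsto_pi_nhds.1 h.1 i) j)
  have e2 := eventually_all.2 fun i => eventually_all.2 fun j =>
    key (tendsto_pi_nhds.1 (tendsto_pi_nhds.1 h.2.1 i) j)
  filter_upwards [e1, e2] with T h1 h2
  exact ⟨hθ, h1, h2⟩

/-- `θ` itself is eventually a competitor, so `distSq (η T) (η' T) ≤ distSq (η T) θ`, which tends to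
zero. -/
lemma ConvergesTo.of_eventually_isSupportProjection {η η' : ℕ → Params p} (h : ConvergesTo η θ)
    (hθ : θ ∈ paramSpace p bmin rhomin rhomax)
    (hp : ∀ᶠ T in atTop, IsSupportProjection bmin rhomin rhomax (η T) (η' T)) :
    ConvergesTo η' θ := by
  refine h.of_distSq (squeeze_zero' (Eventually.of_forall fun T => distSq_nonneg _ _) ?_
    h.tendsto_distSq)
  filter_upwards [hp, h.eventually_mem_supportSpace hθ] with T h1 h2
  exact h1.2 θ h2

end Projection

end BAR

namespace BAR

/-! ### Consistency along a path -/

section Counts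

variable {p : ℕ} {x : ℕ → State p}

lemma count_eq_sum (x : ℕ → State p) (T : ℕ) (u : State p) :
    (count x T u : ℝ) = ∑ k ∈ Finset.range T, if x k = u then 1 else 0 := by
  rw [count, Finset.natCast_card_filter]

lemma countOne_eq_sum (x : ℕ → State p) (T : ℕ) (u : State p) (r : Fin p) :
    (countOne x T u r : ℝ) =
      ∑ k ∈ Finset.range T, if x k = u ∧ x (k + 1) r = true then 1 else 0 := by
  rw [countOne, Finset.natCast_card_filter]

/-- If the transitions into `u` are asymptotically as frequent as predicted, and the
transition probabilities are bounded below, then `u` is visited with positive frequency. -/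
lemma eventually_le_count {u : State p} {K : State p → ℝ} {δ : ℝ} (hδ : 0 < δ)
    (hK : ∀ w, δ ≤ K w)
    (hx : Tendsto (fun T : ℕ => (∑ k ∈ Finset.range T,
      ((if x (k + 1) = u then 1 else 0) - K (x k))) / T) atTop (𝓝 0)) :
    ∀ᶠ T : ℕ in atTop, δ / 2 ≤ (count x T u : ℝ) / T := by
  -- The term `1 / T` pays for the shift between arrivals at times `1, …, T` and visits at times `0,
  -- …, T - 1`.
  have h1 := hx.sub tendsto_one_div_atTop_nhds_zero_nat
  rw [sub_zero] at h1
  filter_upwards [h1.eventually_const_lt (show -(δ / 2) < 0 by linarith), eventually_gt_atTop 0]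
    with T hT hpos
  have hpos' : (0 : ℝ) < T := Nat.cast_pos.2 hpos
  have e1 : ∑ k ∈ Finset.range T, (if x (k + 1) = u then (1 : ℝ) else 0) ≤ count x T u + 1 := by
    have e2 := Finset.sum_range_succ' (fun k => if x k = u then (1 : ℝ) else 0) T
    rw [Finset.sum_range_succ, ← count_eq_sum] at e2
    have e3 : (if x T = u then (1 : ℝ) else 0) ≤ 1 := by split_ifs <;> norm_num
    have e4 : 0 ≤ (if x 0 = u then (1 : ℝ) else 0) := by split_ifs <;> norm_num
    linarith
  have e5 : (T : ℝ) * δ ≤ ∑ k ∈ Finset.range T, K (x k) := by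
    simpa using Finset.card_nsmul_le_sum (Finset.range T) (fun k => K (x k)) δ fun k _ => hK _
  rw [← sub_div, lt_div_iff₀ hpos', Finset.sum_sub_distrib] at hT
  rw [le_div_iff₀ hpos']
  linarith

/-- The error is a centered average divided by the visit frequency. A lower bound on the frequency
suffices; it need not converge. -/
lemma tendsto_ratio {u : State p} {r : Fin p} {q δ : ℝ} (hδ : 0 < δ)
    (hc : ∀ᶠ T : ℕ in atTop, δ ≤ (count x T u : ℝ) / T)
    (hx : Tendsto (fun T : ℕ => (∑ k ∈ Finset.range T,
      if x k = u then (if x (k + 1) r = true then 1 else 0) - q else 0) / T) atTop (𝓝 0)) :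
    Tendsto (fun T => (countOne x T u r : ℝ) / (count x T u : ℝ)) atTop (𝓝 q) := by
  have e : ∀ T, (∑ k ∈ Finset.range T,
      if x k = u then (if x (k + 1) r = true then 1 else 0) - q else 0) =
      countOne x T u r - q * count x T u := fun T => by
    rw [countOne_eq_sum, count_eq_sum, Finset.mul_sum, ← Finset.sum_sub_distrib]
    refine Finset.sum_congr rfl fun k _ => ?_
    by_cases h : x k = u <;> simp [h]
  rw [← tendsto_sub_nhds_zero_iff]
  have h0 := (hx.abs.div_const δ)
  rw [abs_zero, zero_div] at h0
  refine squeeze_zero_norm' ?_ h0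
  filter_upwards [hc, eventually_gt_atTop 0] with T hT hpos
  have hpos' : (0 : ℝ) < T := Nat.cast_pos.2 hpos
  have hcount : (0 : ℝ) < count x T u := by
    have := (le_div_iff₀ hpos').1 hT
    exact (mul_pos hδ hpos').trans_le this
  have e2 : (countOne x T u r : ℝ) / (count x T u : ℝ) - q =
      ((∑ k ∈ Finset.range T,
        if x k = u then (if x (k + 1) r = true then 1 else 0) - q else 0) / T) /
        ((count x T u : ℝ) / T) := by
    rw [e]; field_simp
  rw [e2, Real.norm_eq_abs, abs_div, abs_of_pos (div_pos hcount hpos')]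
  exact div_le_div_of_nonneg_left (abs_nonneg _) hδ hT

lemma mem_visited_of_count_pos {T : ℕ} {u : State p} (h : (0 : ℝ) < count x T u) :
    u ∈ visited x T := by
  have h' : 0 < count x T u := by exact_mod_cast h
  obtain ⟨k, hk⟩ := Finset.card_pos.1 h'
  obtain ⟨hk1, hk2⟩ := Finset.mem_filter.1 hk
  exact Finset.mem_image.2 ⟨k, hk1, hk2⟩

end Counts

/-! ### Least squares once all states have been visited -/

section LeastSquares

variable {p : ℕ} {x : ℕ → State p} {T : ℕ}

lemma goodData_of_visited_eq_univ (h : visited x T = Finset.univ) : GoodData x T := by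
  refine ⟨h ▸ Finset.mem_univ _, ?_⟩
  have hinj : Function.Injective (Umat x T).mulVecLin := by
    rw [← LinearMap.ker_eq_bot, LinearMap.ker_eq_bot']
    intro a ha
    funext j
    -- The row of `U` given by the `j`-th unit vector reads off `a j`.
    have h1 := congrFun ha ⟨fun i => decide (i = j), h ▸ Finset.mem_univ _⟩
    simpa [Matrix.mulVec, dotProduct, Umat, val] using h1
  rw [Matrix.rank, LinearMap.finrank_range_of_inj hinj, Module.finrank_fin_fun]

/-- The Gram matrix of all the states. -/
noncomputable def gramUniv (p : ℕ) : Matrix (Fin p) (Fin p) ℝ :=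
  Matrix.of fun i j => ∑ u : State p, val (u i) * val (u j)

lemma transpose_mul_Umat (h : visited x T = Finset.univ) :
    (Umat x T).transpose * Umat x T = gramUniv p := by
  ext i j
  simp only [Matrix.mul_apply, Matrix.transpose_apply, Umat, Matrix.of_apply, gramUniv]
  rw [Finset.sum_coe_sort (visited x T) fun u => val (u i) * val (u j), h]

lemma AbarHat_of_visited_eq_univ (h : visited x T = Finset.univ) (r : Fin p) :
    AbarHat x T r = (gramUniv p)⁻¹.mulVec fun j => ∑ u : State p, val (u j) *
      ((countOne x T u r : ℝ) / (count x T u : ℝ) - cbarHat x T r) := by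
  change Matrix.mulVec (((Umat x T).transpose * Umat x T)⁻¹)
    (Matrix.mulVec (Umat x T).transpose fun u => yvec x T r u - cbarHat x T r) = _
  rw [transpose_mul_Umat h]
  congr 1
  funext j
  simp only [Matrix.mulVec, dotProduct, Matrix.transpose_apply, Umat, Matrix.of_apply, yvec]
  rw [Finset.sum_coe_sort (visited x T) fun u => val (u j) *
    ((countOne x T u r : ℝ) / (count x T u : ℝ) - cbarHat x T r), h]

lemma oneProb_zeroState (θ : Params p) (i : Fin p) : oneProb θ (zeroState p) i = θ.cbar i := by
  simp [oneProb, zeroState, val]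

lemma tendsto_AbarHat {θ : Params p} (hv : ∀ᶠ T in atTop, visited x T = Finset.univ)
    (hq : ∀ u r, Tendsto (fun T => (countOne x T u r : ℝ) / (count x T u : ℝ)) atTop
      (𝓝 (oneProb θ u r))) : Tendsto (fun T => AbarHat x T) atTop (𝓝 θ.Abar) := by
  -- Invertibility is inherited from any one time at which all states have been visited.
  have hunit : IsUnit (gramUniv p) := by
    obtain ⟨T, hT⟩ := hv.exists
    rw [← transpose_mul_Umat hT]
    exact isUnit_gram (goodData_of_visited_eq_univ hT).2
  refine tendsto_pi_nhds.2 fun r => ?_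
  -- The limiting data are exactly linear in `u` with coefficients `ā_r`, so `ā_r` solves the
  -- limiting normal equation.
  have hlim : (gramUniv p)⁻¹.mulVec (fun j => ∑ u : State p, val (u j) *
      (oneProb θ u r - oneProb θ (zeroState p) r)) = θ.Abar r := by
    have e : (fun j => ∑ u : State p, val (u j) *
        (oneProb θ u r - oneProb θ (zeroState p) r)) = (gramUniv p).mulVec (θ.Abar r) := by
      have hd : ∀ u, oneProb θ u r - oneProb θ (zeroState p) r =
          ∑ j, θ.Abar r j * val (u j) := fun u => by
        rw [oneProb_zeroState, oneProb, add_sub_cancel_right]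
      funext j
      simp only [hd, Matrix.mulVec, dotProduct, gramUniv, Matrix.of_apply, Finset.mul_sum,
        Finset.sum_mul]
      rw [Finset.sum_comm]
      exact Finset.sum_congr rfl fun i _ => Finset.sum_congr rfl fun u _ => by ring
    rw [e, Matrix.mulVec_mulVec,
      Matrix.nonsing_inv_mul _ ((Matrix.isUnit_iff_isUnit_det _).1 hunit), Matrix.one_mulVec]
  have hconv : Tendsto (fun T => (gramUniv p)⁻¹.mulVec (fun j => ∑ u : State p, val (u j) *
      ((countOne x T u r : ℝ) / (count x T u : ℝ) - cbarHat x T r))) atTop (𝓝 (θ.Abar r)) := by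
    rw [← hlim]
    refine ((continuous_const.matrix_mulVec continuous_id).tendsto _).comp
      (tendsto_pi_nhds.2 fun j => tendsto_finsetSum _ fun u _ => Tendsto.const_mul _
        ((hq u r).sub (hq (zeroState p) r)))
  refine hconv.congr' ?_
  filter_upwards [hv] with T hT
  exact (AbarHat_of_visited_eq_univ hT r).symm

end LeastSquares

/-! ### Almost sure consistency for the process -/

section Consistency

variable {p : ℕ} {bmin rhomin rhomax : ℝ} {Ω : Type*} [MeasurableSpace Ω] {μ : Measure Ω}
  [IsProbabilityMeasure μ] {θ : Params p} {X W : ℕ → Ω → State p}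

lemma IsGenericBAR.ae_counts (h : IsGenericBAR θ μ X W) (hb₀ : 0 < bmin) (hr₀ : 0 < rhomin)
    (hr₁ : rhomax < 1) (hθ : θ ∈ paramSpace p bmin rhomin rhomax) :
    ∀ᵐ ω ∂μ, (∀ᶠ T in atTop, visited (fun k => X k ω) T = Finset.univ) ∧
      ∀ u r, Tendsto (fun T => (countOne (fun k => X k ω) T u r : ℝ) /
        (count (fun k => X k ω) T u : ℝ)) atTop (𝓝 (oneProb θ u r)) := by
  -- There are finitely many pairs of states, so the positive transition probabilities have a
  -- positive minimum `δ`.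
  obtain ⟨z, hz⟩ := Finite.exists_min fun z : State p × State p => trans θ z.1 z.2
  set δ := trans θ z.1 z.2 with hδ
  have hδ0 : 0 < δ := trans_pos hb₀ hr₀ hr₁ hθ _ _
  -- First centered function: arrivals at `u` minus their conditional probability, for the visit
  -- frequencies.
  have a1 : ∀ u, ∀ᵐ ω ∂μ, Tendsto (fun T : ℕ => (∑ k ∈ Finset.range T,
      ((if X (k + 1) ω = u then 1 else 0) - trans θ (X k ω) u)) / T) atTop (𝓝 0) := fun u =>
    h.ae_tendsto_average (f := fun w v => (if v = u then 1 else 0) - trans θ w u) fun w => by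
      simp [mul_sub, Finset.sum_sub_distrib, ← Finset.sum_mul, sum_trans_eq_one]
  -- Second centered function: the fluctuation of coordinate `r` after a visit to `u`, for the
  -- ratios.
  have a2 : ∀ u r, ∀ᵐ ω ∂μ, Tendsto (fun T : ℕ => (∑ k ∈ Finset.range T,
      if X k ω = u then (if X (k + 1) ω r = true then 1 else 0) - oneProb θ u r else 0) / T)
      atTop (𝓝 0) := fun u r =>
    h.ae_tendsto_average (f := fun w v => if w = u then
      (if v r = true then 1 else 0) - oneProb θ u r else 0) fun w => by
      by_cases hw : w = u
      · simp only [hw, if_true, mul_sub, Finset.sum_sub_distrib, ← Finset.sum_mul,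
          sum_trans_eq_one, sum_trans_mul_ite, one_mul, sub_self]
      · simp [hw]
  filter_upwards [ae_all_iff.2 a1, ae_all_iff.2 fun u => ae_all_iff.2 (a2 u)] with ω h1 h2
  have hc : ∀ u, ∀ᶠ T : ℕ in atTop, δ / 2 ≤ (count (fun k => X k ω) T u : ℝ) / T := fun u =>
    eventually_le_count hδ0 (K := fun w => trans θ w u) (fun w => hz (w, u)) (h1 u)
  refine ⟨?_, fun u r => tendsto_ratio (half_pos hδ0) (hc u) (h2 u r)⟩
  filter_upwards [eventually_all.2 hc] with T hT
  refine Finset.eq_univ_of_forall fun u => mem_visited_of_count_pos ?_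
  by_contra h0
  have h3 := (half_pos hδ0).trans_le (hT u)
  exact h3.not_ge (div_nonpos_of_nonpos_of_nonneg (not_lt.1 h0) (Nat.cast_nonneg T))

lemma IsGenericBAR.ae_tendsto_hat (h : IsGenericBAR θ μ X W) (hb₀ : 0 < bmin) (hr₀ : 0 < rhomin)
    (hr₁ : rhomax < 1) (hθ : θ ∈ paramSpace p bmin rhomin rhomax) :
    ∀ᵐ ω ∂μ, (∀ᶠ T in atTop, GoodData (fun k => X k ω) T) ∧
      Tendsto (fun T => AbarHat (fun k => X k ω) T) atTop (𝓝 θ.Abar) ∧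
      Tendsto (fun T => cbarHat (fun k => X k ω) T) atTop (𝓝 θ.cbar) := by
  filter_upwards [h.ae_counts hb₀ hr₀ hr₁ hθ] with ω ⟨hv, hq⟩
  refine ⟨hv.mono fun T hT => goodData_of_visited_eq_univ hT, tendsto_AbarHat hv hq,
    tendsto_pi_nhds.2 fun i => ?_⟩
  rw [← oneProb_zeroState]
  exact hq (zeroState p) i

lemma ConvergesTo.eventually_b_ne_zero {η : ℕ → Params p} (h : ConvergesTo η θ) (hb₀ : 0 < bmin)
    (hθ : θ ∈ paramSpace p bmin rhomin rhomax) : ∀ᶠ T in atTop, ∀ i, (η T).b i ≠ 0 :=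
  eventually_all.2 fun i =>
    (tendsto_pi_nhds.1 h.2.2.1 i).eventually_ne (hb₀.trans_le (hθ i).2.1).ne'

end Consistency

end BAR

theorem theorem5 (p : ℕ) (bmin rhomin rhomax : ℝ) (hb₀ : 0 < bmin) (hb₁ : bmin < 1)
    (hr₀ : 0 < rhomin) (hr : rhomin < rhomax) (hr₁ : rhomax < 1) :
    -- the parameters are recovered from the reparametrization
    (∀ θ ∈ BAR.paramSpace p bmin rhomin rhomax, BAR.recover θ.Abar θ.cbar = θ) ∧
    -- the least squares estimator is well defined and is given by the formula
    (∀ (x : ℕ → BAR.State p) (T : ℕ), BAR.GoodData x T →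
      IsUnit ((BAR.Umat x T).transpose * BAR.Umat x T) ∧
      ∀ (r : Fin p) (a : Fin p → ℝ), a ≠ BAR.AbarHat x T r →
        BAR.residual x T r (BAR.AbarHat x T r) < BAR.residual x T r a) ∧
    -- the support-preserving projection exists and is unique, for all data
    (∀ (x : ℕ → BAR.State p) (T : ℕ), ∃! θ' : BAR.Params p,
      BAR.IsSupportProjection bmin rhomin rhomax (BAR.rawEstimate x T) θ') ∧
    -- for every generic BAR process with parameters in the parameter space:
    (∀ (Ω : Type*) [MeasurableSpace Ω] (μ : MeasureTheory.Measure Ω)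
      [MeasureTheory.IsProbabilityMeasure μ] (θ : BAR.Params p)
      (X W : ℕ → Ω → BAR.State p),
      θ ∈ BAR.paramSpace p bmin rhomin rhomax → BAR.IsGenericBAR θ μ X W →
      -- `P(X_i(k+1) = 1 | X(k) = u) = ā_iᵀ u + c̄_i`
      (∀ (k : ℕ) (u : BAR.State p) (i : Fin p),
        μ.real {ω | X k ω = u ∧ X (k + 1) ω i = true} =
          μ.real {ω | X k ω = u} * (∑ j, θ.Abar i j * BAR.val (u j) + θ.cbar i)) ∧
      -- almost surely, the estimator is eventually defined
      (∀ᵐ ω ∂μ, ∀ᶠ T in Filter.atTop, BAR.GoodData (fun k => X k ω) T ∧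
        ∀ i, (BAR.rawEstimate (fun k => X k ω) T).b i ≠ 0) ∧
      -- strong consistency for `(Ā, c̄)`
      (∀ᵐ ω ∂μ,
        Filter.Tendsto (fun T => BAR.AbarHat (fun k => X k ω) T) Filter.atTop (nhds θ.Abar) ∧
        Filter.Tendsto (fun T => BAR.cbarHat (fun k => X k ω) T) Filter.atTop (nhds θ.cbar)) ∧
      -- strong consistency of the unprojected estimator
      (∀ᵐ ω ∂μ, BAR.ConvergesTo (fun T => BAR.rawEstimate (fun k => X k ω) T) θ) ∧
      -- strong consistency of the closed-form estimator
      (∀ est : (ℕ → BAR.State p) → ℕ → BAR.Params p,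
        BAR.IsClosedFormEstimator bmin rhomin rhomax est →
        ∀ᵐ ω ∂μ, BAR.ConvergesTo (fun T => est (fun k => X k ω) T) θ)) := by
  refine ⟨fun θ hθ => BAR.recover_Abar_cbar hb₀ hθ,
    fun x T h => ⟨BAR.isUnit_gram h.2, fun r a ha => h.residual_lt r ha⟩,
    fun x T => BAR.existsUnique_isSupportProjection hb₀.le hb₁.le hr₀.le hr.le hr₁.le
      (BAR.recover_A_or_Aneg_eq_zero _ _), ?_⟩
  intro Ω _ μ _ θ X W hθ h
  have hconv := h.ae_tendsto_hat hb₀ hr₀ hr₁ hθ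
  have hraw : ∀ᵐ ω ∂μ, BAR.ConvergesTo (fun T => BAR.rawEstimate (fun k => X k ω) T) θ := by
    filter_upwards [hconv] with ω hω
    exact BAR.convergesTo_recover hb₀ hθ hω.2.1 hω.2.2
  have hgood : ∀ᵐ ω ∂μ, ∀ᶠ T in Filter.atTop, BAR.GoodData (fun k => X k ω) T ∧
      ∀ i, (BAR.rawEstimate (fun k => X k ω) T).b i ≠ 0 := by
    filter_upwards [hconv, hraw] with ω hω hω'
    exact hω.1.and (hω'.eventually_b_ne_zero hb₀ hθ)
  refine ⟨h.measureReal_step, hgood, hconv.mono fun ω hω => hω.2, hraw, fun est hest => ?_⟩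
  filter_upwards [hraw, hgood] with ω h1 h2
  exact h1.of_eventually_isSupportProjection hθ (h2.mono fun T hT => hest _ T hT.1 hT.2)
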